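/- Let $\mathcal H$ be a complex Hilbert space (inner product antilinear in the first argument). A linear relation in $\mathcal H$ is a linear subset of $\mathcal H\oplus\mathcal H$; an operator is identified with its graph, and the adjoint of a relation $T$ is $T^*=\{(\eta,\omega):\langle\eta,\psi\rangle=\langle\omega,\phi\rangle\text{ for all }(\phi,\psi)\in T\}$. Let $\mathscr S(\mathcal H)$ be the set of all closed operators $A$ in $\mathcal H$, not necessarily densely defined, such that $A\subset A^*$ (symmetry), for every $z\in\mathbb C$ there is $c_z>0$ with $\|(A-zI)\phi\|\ge c_z\|\phi\|$ for all $\phi\in\operatorname{dom}(A)$ (regularity), and $\dim[\mathcal H\ominus\operatorname{ran}(A-zI)]=1$ for all $z\in\mathbb C\setminus\mathbb R$ (both deficiency indices equal $1$). A canonical selfadjoint extension of $A$ is a linear relation $A_\gamma$ in $\mathcal H$ with $A\subset A_\gamma=A_\gamma^*$. Let $A\in\mathscr S(\mathcal H)$. Let $J:\mathcal H\to\mathcal H$ be an involution, i.e. $J(a\phi+b\psi)=\overline aJ\phi+\overline bJ\psi$, $J^2=I$ and $\langle J\psi,J\phi\rangle=\langle\phi,\psi\rangle$, which commutes with all canonical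 selfadjoint extensions $A_\gamma$ of $A$, i.e. $J(A_\gamma-zI)^{-1}=(A_\gamma-\overline zI)^{-1}J$ for all $z\in\mathbb C\setminus\mathbb R$. Let $\xi_A:\mathbb C\to\mathcal H$ be entire and zero-free, with $\xi_A(z)\in\ker(A^*-zI)$ and $J\xi_A(z)=\xi_A(\overline z)$ for all $z\in\mathbb C$. For $\varphi\in\mathcal H$ put $(\Phi_A\varphi)(z)=\langle\xi_A(\overline z),\varphi\rangle$, $z\in\mathbb C$, and let $\widehat{\mathcal H}=\Phi_A\mathcal H$. Then $\Phi_A$ is injective, so that $\langle\Phi_A\eta,\Phi_A\varphi\rangle:=\langle\eta,\varphi\rangle$ defines an inner product on $\widehat{\mathcal H}$ for which $\Phi_A$ is an isometry of $\mathcal H$ onto $\widehat{\mathcal H}$. With this inner product $\widehat{\mathcal H}$ is a de Branges (dB) space, that is, a Hilbert space of entire functions such that for every $f\in\widehat{\mathcal H}$: point evaluation $f\mapsto f(w)$ is continuous for each $w\in\mathbb C$; for every nonreal zero $w$ of $f$ the function $f(z)(z-\overline w)(z-w)^{-1}$ belongs to $\widehat{\mathcal H}$ and has the same norm as $f$; and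 $f^\#(z):=\overline{f(\overline z)}$ belongs to $\widehat{\mathcal H}$ and has the same norm as $f$. Let $S$ be the operator of multiplication by the independent variable in $\widehat{\mathcal H}$: $\operatorname{dom}(S)=\{f\in\widehat{\mathcal H}:zf(z)\in\widehat{\mathcal H}\}$, $(Sf)(z)=zf(z)$. Then: (i) $S=\Phi_AA\Phi_A^{-1}$ and $\operatorname{dom}(S)=\Phi_A\operatorname{dom}(A)$. (ii) $\Phi_AJ\Phi_A^{-1}f=f^\#$ for every $f\in\widehat{\mathcal H}$. (iii) If $A_\gamma$ is a canonical selfadjoint extension of $A$, then $\Phi_AA_\gamma\Phi_A^{-1}=\{(\Phi_A\phi,\Phi_A\psi):(\phi,\psi)\in A_\gamma\}$ is a canonical selfadjoint extension of $S$. -/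

import Mathlib

open scoped ComplexConjugate

noncomputable section

namespace FunctionalModel

section Relations

variable {H : Type*} [NormedAddCommGroup H] [InnerProductSpace ℂ H]

/-- `ran (A - z I)`. -/
def ranSub (A : H →ₗ.[ℂ] H) (z : ℂ) : Submodule ℂ H :=
  LinearMap.range (A.toFun - z • A.domain.subtype)

/-- A (not necessarily densely defined) operator is symmetric if `A ⊂ A*` as linear relations. -/
def IsSymmetricOp (A : H →ₗ.[ℂ] H) : Prop :=
  A.graph ≤ A.graph.adjoint

/-- Every complex number is a point of regular type. -/
def IsRegularOp (A : H →ₗ.[ℂ] H) : Prop :=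
  ∀ z : ℂ, ∃ c : ℝ, 0 < c ∧ ∀ φ : A.domain, c * ‖(φ : H)‖ ≤ ‖A φ - z • (φ : H)‖

/-- The class `𝒮(H)`: regular, closed, symmetric operators with deficiency indices
`n₊(A) = n₋(A) = 1`, where `n₊(A) = dim (H ⊖ ran (A - z I))` for `z` in the upper half-plane, and
`n₋(A)` is the same dimension for `z` in the lower half-plane. The domain need not be dense. -/
structure MemS (A : H →ₗ.[ℂ] H) : Prop where
  isClosed : A.IsClosed
  symmetric : IsSymmetricOp A
  regular : IsRegularOp A
  deficiency_upper : ∀ z : ℂ, 0 < z.im → Module.finrank ℂ (ranSub A z)ᗮ = 1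
  deficiency_lower : ∀ z : ℂ, z.im < 0 → Module.finrank ℂ (ranSub A z)ᗮ = 1

/-- The linear relation `T` is a canonical selfadjoint extension of the operator `A`:
`A ⊂ T = T*`, inside `H ⊕ H`. -/
structure IsCanonicalSelfAdjointExtension (A : H →ₗ.[ℂ] H) (T : Submodule ℂ (H × H)) : Prop where
  extends_graph : A.graph ≤ T
  selfAdjoint : T.adjoint = T

/-- An involution: a conjugate-linear map with `J² = I` and `⟪J ψ, J φ⟫ = ⟪φ, ψ⟫`. -/
structure IsInvolution (J : H → H) : Prop where
  conj_linear : ∀ (a b : ℂ) (φ ψ : H), J (a • φ + b • ψ) = conj a • J φ + conj b • J ψ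
  involutive : ∀ φ : H, J (J φ) = φ
  inner_map_map : ∀ φ ψ : H, inner ℂ (J ψ) (J φ) = inner ℂ φ ψ

/-- The relation `(T - z I)⁻¹`: it contains `(φ, η)` when `(η, φ + z η) ∈ T`. -/
def resolventRel (T : Submodule ℂ (H × H)) (z : ℂ) : Set (H × H) :=
  {p | (p.2, p.1 + z • p.2) ∈ T}

/-- `J (T - z I)⁻¹ φ = (T - conj z I)⁻¹ J φ` for all `φ` and all nonreal `z`. For a selfadjoint
relation `T` both resolvents are everywhere defined operators, and the equation says that `J`
carries the graph of the first one into the graph of the second one. -/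
def CommutesWith (J : H → H) (T : Submodule ℂ (H × H)) : Prop :=
  ∀ z : ℂ, z.im ≠ 0 → ∀ φ η : H,
    (φ, η) ∈ resolventRel T z → (J φ, J η) ∈ resolventRel T (conj z)

/-- The properties of the function `ξ` on which the functional model of `A` is built. -/
structure IsModelFunction (A : H →ₗ.[ℂ] H) (J : H → H) (ξ : ℂ → H) : Prop where
  entire : Differentiable ℂ ξ
  zero_free : ∀ z : ℂ, ξ z ≠ 0
  /-- `ξ z` lies in `ker (A* - z I)`. -/
  mem_ker : ∀ z : ℂ, (ξ z, z • ξ z) ∈ A.graph.adjoint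
  map_conj : ∀ z : ℂ, J (ξ z) = ξ (conj z)

variable {K : Type*} [NormedAddCommGroup K] [InnerProductSpace ℂ K]

/-- The operator `U A U⁻¹`, with domain `U (dom A)`. -/
def transportOp (U : H ≃ₗᵢ[ℂ] K) (A : H →ₗ.[ℂ] H) : K →ₗ.[ℂ] K where
  domain := A.domain.map U.toLinearEquiv.toLinearMap
  toFun := U.toLinearEquiv.toLinearMap ∘ₗ A.toFun ∘ₗ
    (U.toLinearEquiv.submoduleMap A.domain).symm.toLinearMap

/-- The linear relation `U T U⁻¹ = {(U φ, U ψ) | (φ, ψ) ∈ T}`. -/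
def transportRel (U : H ≃ₗᵢ[ℂ] K) (T : Submodule ℂ (H × H)) : Submodule ℂ (K × K) :=
  T.map (U.toLinearEquiv.toLinearMap.prodMap U.toLinearEquiv.toLinearMap)

end Relations

section DeBranges

variable (B : Type*) [NormedAddCommGroup B] [InnerProductSpace ℂ B] [RKHS ℂ B ℂ ℂ]

/-- The axioms of a de Branges space for a Hilbert space `B` of functions `ℂ → ℂ` with the pointwise
operations. That point evaluations are continuous on `B` is part of `RKHS`. -/
structure IsDeBrangesSpace : Prop where
  complete : CompleteSpace B
  entire : ∀ f : B, Differentiable ℂ (f : ℂ → ℂ)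
  /-- If `w` is a nonreal zero of `f`, the entire function `f(z) (z - conj w) / (z - w)` is in `B`
  and has the norm of `f`. -/
  divide_zero : ∀ (f : B) (w : ℂ), w.im ≠ 0 → f w = 0 →
    ∃ g : B, (∀ z : ℂ, z ≠ w → g z = f z * (z - conj w) / (z - w)) ∧ ‖g‖ = ‖f‖
  /-- `f^#(z) = conj (f (conj z))` is in `B` and has the norm of `f`. -/
  sharp : ∀ f : B, ∃ g : B, (∀ z : ℂ, g z = conj (f (conj z))) ∧ ‖g‖ = ‖f‖

/-- The operator `S` of multiplication by the independent variable:
`dom S = {f ∈ B | z f(z) ∈ B}`, `(S f)(z) = z f(z)`. -/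
def mulOp : B →ₗ.[ℂ] B where
  domain :=
    { carrier := {f | ∃ g : B, ∀ z : ℂ, g z = z * f z}
      zero_mem' := ⟨0, fun z => by simp⟩
      add_mem' := by
        rintro f₁ f₂ ⟨g₁, h₁⟩ ⟨g₂, h₂⟩
        exact ⟨g₁ + g₂, fun z => by simp [h₁, h₂, mul_add]⟩
      smul_mem' := by
        rintro c f ⟨g, h⟩
        exact ⟨c • g, fun z => by simp [h, mul_left_comm]⟩ }
  toFun :=
    { toFun := fun f => f.2.choose
      map_add' := fun f₁ f₂ => RKHS.ext fun z => by
        rw [(f₁ + f₂).2.choose_spec, RKHS.coe_add, Pi.add_apply, f₁.2.choose_spec,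
          f₂.2.choose_spec, Submodule.coe_add, RKHS.coe_add, Pi.add_apply, mul_add]
      map_smul' := fun c f => RKHS.ext fun z => by
        rw [(c • f).2.choose_spec, RingHom.id_apply, RKHS.coe_smul, Pi.smul_apply,
          f.2.choose_spec, Submodule.coe_smul, RKHS.coe_smul, Pi.smul_apply, smul_eq_mul,
          smul_eq_mul, mul_left_comm] }

variable {B} in
theorem mulOp_apply (f : (mulOp B).domain) (z : ℂ) : mulOp B f z = z * (f : B) z :=
  f.2.choose_spec z

end DeBranges

section Model

variable {H : Type*} [NormedAddCommGroup H] [InnerProductSpace ℂ H]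

/-- `(Φ φ)(z) = ⟪ξ (conj z), φ⟫`, as a linear map from `H` to functions on `ℂ`. -/
def phiMap (ξ : ℂ → H) : H →ₗ[ℂ] (ℂ → ℂ) where
  toFun φ z := inner ℂ (ξ (conj z)) φ
  map_add' φ ψ := by ext z; simp
  map_smul' c φ := by ext z; simp

/-- The space of functions `Φ H`, for injective `Φ`. Its inner product, defined below, is
`⟪Φ η, Φ φ⟫ = ⟪η, φ⟫`. -/
def ModelSpace (ξ : ℂ → H) (_hΦ : Function.Injective (phiMap ξ)) : Type :=
  LinearMap.range (phiMap ξ)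

variable {ξ : ℂ → H} {hΦ : Function.Injective (phiMap ξ)}

instance : AddCommGroup (ModelSpace ξ hΦ) :=
  inferInstanceAs (AddCommGroup (LinearMap.range (phiMap ξ)))

instance : Module ℂ (ModelSpace ξ hΦ) :=
  inferInstanceAs (Module ℂ (LinearMap.range (phiMap ξ)))

/-- `Φ` as a linear bijection of `H` onto `Φ H`. -/
def phiLinearEquiv (ξ : ℂ → H) (hΦ : Function.Injective (phiMap ξ)) : H ≃ₗ[ℂ] ModelSpace ξ hΦ :=
  LinearEquiv.ofInjective (phiMap ξ) hΦ

instance : NormedAddCommGroup (ModelSpace ξ hΦ) :=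
  NormedAddCommGroup.induced _ H (phiLinearEquiv ξ hΦ).symm (phiLinearEquiv ξ hΦ).symm.injective

instance : InnerProductSpace ℂ (ModelSpace ξ hΦ) where
  inner f g := inner ℂ ((phiLinearEquiv ξ hΦ).symm f) ((phiLinearEquiv ξ hΦ).symm g)
  norm_smul_le c f := by
    change ‖(phiLinearEquiv ξ hΦ).symm (c • f)‖ ≤ ‖c‖ * ‖(phiLinearEquiv ξ hΦ).symm f‖
    rw [map_smul, norm_smul]
  norm_sq_eq_re_inner f := norm_sq_eq_re_inner ((phiLinearEquiv ξ hΦ).symm f)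
  conj_inner_symm f g := inner_conj_symm _ _
  add_left f g k := by rw [map_add, inner_add_left]
  smul_left f g c := by rw [map_smul, inner_smul_left]

/-- `Φ` as an isometry of `H` onto `Φ H`. -/
def phi (ξ : ℂ → H) (hΦ : Function.Injective (phiMap ξ)) : H ≃ₗᵢ[ℂ] ModelSpace ξ hΦ where
  toLinearEquiv := phiLinearEquiv ξ hΦ
  norm_map' φ := by
    change ‖(phiLinearEquiv ξ hΦ).symm (phiLinearEquiv ξ hΦ φ)‖ = ‖φ‖
    rw [LinearEquiv.symm_apply_apply]

/-- The elements of `Φ H` are functions on `ℂ`; their point evaluations are continuous. -/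
instance : RKHS ℂ (ModelSpace ξ hΦ) ℂ ℂ where
  coeCLM :=
    { toFun := fun f => f.1
      map_add' := fun _ _ => rfl
      map_smul' := fun _ _ => rfl
      cont := by
        refine continuous_pi fun z => ?_
        have h : ∀ f : ModelSpace ξ hΦ, f.1 z = inner ℂ (ξ (conj z)) ((phi ξ hΦ).symm f) := by
          intro f
          obtain ⟨φ, rfl⟩ := (phi ξ hΦ).surjective f
          rw [LinearIsometryEquiv.symm_apply_apply]
          rfl
        simp_rw [h]
        fun_prop }
  coeCLM_injective := Subtype.val_injective

theorem phi_apply (φ : H) (z : ℂ) : phi ξ hΦ φ z = inner ℂ (ξ (conj z)) φ := rfl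

end Model

end FunctionalModel

end

open scoped ComplexConjugate Topology
open Filter

namespace FunctionalModel

/-! ### Ranges of `A - z I` and analyticity of the resolvent. -/

section Operators

variable {H : Type*} [NormedAddCommGroup H] [InnerProductSpace ℂ H] {A : H →ₗ.[ℂ] H}

/-! Since `ξ (conj z)` is an eigenvector of `A*`, pairing gives `⟪ξ (conj z), (A - w) x⟫ = (z - w)
⟪ξ (conj z), x⟫`: `Φ` turns `A` into multiplication by `z`. Conversely, for nonreal `w`, deficiency
index 1 and closed range give `(Φ φ)(w) = 0` only if `φ = (A - w) x`
(`mem_ranSub_of_inner_eq_zero`).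

Everything follows. If `Φ φ = 0`, then `φ` lies in every range, `(A - z)⁻¹ φ` is entire and bounded
by `‖φ‖ / |Im z|`, hence zero, and so is `φ`. Dividing out a zero `w` replaces `(A - w) x` by `(A -
conj w) x`, which has the same norm by symmetry. If `z f(z)` is in the space, dividing `(z - i)
f(z)` by `z - i` shows that `f` comes from `dom A`. Finally `J` induces `f ↦ f^#`, and adjoints are
unitarily invariant. -/

theorem mem_ranSub {z : ℂ} {y : H} :
    y ∈ ranSub A z ↔ ∃ x : A.domain, A x - z • (x : H) = y := Iff.rfl

theorem ranSub_isClosed [CompleteSpace H] (hcl : A.IsClosed) (hreg : IsRegularOp A) (z : ℂ) :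
    IsClosed (ranSub A z : Set H) := by
  obtain ⟨c, hc, hbound⟩ := hreg z
  have : CompleteSpace A.graph := IsClosed.completeSpace_coe (hs := hcl)
  let L : A.graph →L[ℂ] H :=
    (ContinuousLinearMap.snd ℂ H H - z • ContinuousLinearMap.fst ℂ H H).comp A.graph.subtypeL
  have hL : ∀ p : A.graph, L p = (p : H × H).2 - z • (p : H × H).1 := fun p => rfl
  -- With `x` the first component of `p`, `‖x‖ ≤ c⁻¹ ‖L p‖` and `‖A x‖ ≤ (1 + ‖z‖ c⁻¹) ‖L p‖`; the
  -- constant dominates both.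
  have hanti : AntilipschitzWith (1 + c⁻¹ * (1 + ‖z‖)).toNNReal L := by
    refine L.antilipschitz_of_bound fun p => ?_
    rw [Real.coe_toNNReal _ (by positivity)]
    obtain ⟨x, hx⟩ := (LinearPMap.mem_graph_iff' A).1 p.2
    have h₁ : (p : H × H).1 = x := by rw [← hx]
    have h₂ : (p : H × H).2 = A x := by rw [← hx]
    have hx₁ : ‖(x : H)‖ ≤ c⁻¹ * ‖L p‖ := by
      rw [inv_mul_eq_div, le_div_iff₀ hc, mul_comm, hL, h₁, h₂]
      exact hbound x
    have hx₂ : ‖A x‖ ≤ ‖L p‖ + ‖z‖ * ‖(x : H)‖ := by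
      rw [hL, h₁, h₂, ← norm_smul]
      simpa using norm_add_le (A x - z • (x : H)) (z • (x : H))
    have hx₃ := mul_le_mul_of_nonneg_left hx₁ (norm_nonneg z)
    change ‖(p : H × H)‖ ≤ _
    rw [Prod.norm_def, h₁, h₂]
    have h0 : 0 ≤ ‖L p‖ := norm_nonneg _
    have h3 : 0 ≤ c⁻¹ * ‖L p‖ := by positivity
    have h4 : 0 ≤ ‖z‖ * (c⁻¹ * ‖L p‖) := by positivity
    refine max_le ?_ ?_ <;> nlinarith
  convert hanti.isClosed_range L.uniformContinuous
  ext y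
  rw [SetLike.mem_coe, mem_ranSub]
  constructor
  · rintro ⟨x, rfl⟩
    exact ⟨⟨(x, A x), A.mem_graph x⟩, rfl⟩
  · rintro ⟨p, rfl⟩
    obtain ⟨x, hx⟩ := (LinearPMap.mem_graph_iff' A).1 p.2
    exact ⟨x, by rw [hL, ← hx]⟩

theorem IsRegularOp.eventually_bound (hreg : IsRegularOp A) (z : ℂ) :
    ∃ c : ℝ, 0 < c ∧ ∀ᶠ w in 𝓝 z, ∀ x : A.domain, c * ‖(x : H)‖ ≤ ‖A x - w • (x : H)‖ := by
  obtain ⟨c, hc, hbound⟩ := hreg z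
  refine ⟨c / 2, half_pos hc, ?_⟩
  filter_upwards [Metric.ball_mem_nhds z (half_pos hc)] with w hw x
  rw [Metric.mem_ball, dist_eq_norm] at hw
  have h₁ : ‖A x - z • (x : H)‖ ≤ ‖A x - w • (x : H)‖ + ‖w - z‖ * ‖(x : H)‖ := by
    rw [← norm_smul]
    refine le_trans (le_of_eq ?_) (norm_add_le _ _)
    congr 1
    module
  have h₂ := mul_le_mul_of_nonneg_right hw.le (norm_nonneg (x : H))
  linarith [hbound x]

theorem IsRegularOp.sub_smul_injective (hreg : IsRegularOp A) {z : ℂ} {x y : A.domain}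
    (h : A x - z • (x : H) = A y - z • (y : H)) : x = y := by
  obtain ⟨c, hc, hbound⟩ := hreg z
  have h₁ := hbound (x - y)
  have h₂ : A (x - y) - z • ((x - y : A.domain) : H) = 0 := by
    rw [LinearPMap.map_sub, Submodule.coe_sub, smul_sub, ← sub_eq_zero.2 h]
    abel
  rw [h₂, norm_zero] at h₁
  have h₃ : ‖((x - y : A.domain) : H)‖ ≤ 0 := by
    by_contra! h
    exact absurd h₁ (not_le.2 (mul_pos hc h))
  exact sub_eq_zero.1 (Subtype.ext (norm_le_zero_iff.1 h₃))

/-- The first resolvent identity, for a single vector `φ` on which all resolvents of `A` are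
defined. -/
theorem sub_smul_resolvent {φ : H} {η : ℂ → A.domain}
    (hη : ∀ w, A (η w) - w • (η w : H) = φ) (w z : ℂ) :
    A (η w - η z) - w • ((η w - η z : A.domain) : H) = (w - z) • (η z : H) := by
  have h : A (η w) - w • (η w : H) = A (η z) - z • (η z : H) := by rw [hη, hη]
  rw [LinearPMap.map_sub, Submodule.coe_sub, eq_add_of_sub_eq h]
  module

theorem IsRegularOp.continuous_resolvent (hreg : IsRegularOp A) {φ : H} {η : ℂ → A.domain}
    (hη : ∀ w, A (η w) - w • (η w : H) = φ) : Continuous fun w => (η w : H) := by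
  refine continuous_iff_continuousAt.2 fun z => ?_
  obtain ⟨c, hc, hbound⟩ := hreg.eventually_bound z
  refine tendsto_iff_norm_sub_tendsto_zero.2 ?_
  have hlim : Tendsto (fun w => c⁻¹ * (‖w - z‖ * ‖(η z : H)‖)) (𝓝 z) (𝓝 0) := by
    have : Continuous fun w => c⁻¹ * (‖w - z‖ * ‖(η z : H)‖) := by fun_prop
    simpa using this.tendsto z
  refine squeeze_zero' (Eventually.of_forall fun w => norm_nonneg _) ?_ hlim
  filter_upwards [hbound] with w hw
  have h := hw (η w - η z)
  rw [sub_smul_resolvent hη, norm_smul] at h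
  rw [inv_mul_eq_div, le_div_iff₀ hc, mul_comm]
  exact h

theorem IsRegularOp.resolvent_mem_ranSub [CompleteSpace H] (hcl : A.IsClosed)
    (hreg : IsRegularOp A) {φ : H} {η : ℂ → A.domain}
    (hη : ∀ w, A (η w) - w • (η w : H) = φ) (z w : ℂ) : (η z : H) ∈ ranSub A w := by
  have hne : ∀ z w : ℂ, z ≠ w → (η z : H) ∈ ranSub A w := by
    intro z w hzw
    have h : (w - z) • (η z : H) ∈ ranSub A w :=
      mem_ranSub.2 ⟨η w - η z, sub_smul_resolvent hη w z⟩
    exact ((ranSub A w).smul_mem_iff (sub_ne_zero.2 hzw.symm)).1 h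
  rcases eq_or_ne z w with rfl | hzw
  -- The identity gives nothing at `w = z`; there `η z` is a limit of `η w ∈ ran (A - z I)`.
  · refine (ranSub_isClosed hcl hreg z).mem_of_tendsto (f := fun w => (η w : H)) (b := 𝓝[≠] z)
      ((hreg.continuous_resolvent hη).tendsto z |>.mono_left nhdsWithin_le_nhds) ?_
    filter_upwards [self_mem_nhdsWithin] with w hw using hne w z hw
  · exact hne z w hzw

theorem IsRegularOp.differentiable_resolvent [CompleteSpace H] (hcl : A.IsClosed)
    (hreg : IsRegularOp A) {φ : H} {η : ℂ → A.domain}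
    (hη : ∀ w, A (η w) - w • (η w : H) = φ) : Differentiable ℂ fun w => (η w : H) := by
  intro z
  -- The difference quotient of `η` at `z` is `ζ w = (A - w)⁻¹ η z`, again a resolvent family and so
  -- continuous; the derivative is `ζ z`.
  choose ζ hζ using fun w => mem_ranSub.1 (hreg.resolvent_mem_ranSub hcl hη z w)
  refine HasDerivAt.differentiableAt (f' := (ζ z : H)) (hasDerivAt_iff_tendsto_slope.2 ?_)
  refine Tendsto.congr' ?_
    ((hreg.continuous_resolvent hζ).tendsto z |>.mono_left nhdsWithin_le_nhds)
  filter_upwards [self_mem_nhdsWithin] with w hw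
  have h : η w - η z = (w - z) • ζ w := by
    apply hreg.sub_smul_injective (z := w)
    rw [sub_smul_resolvent hη, LinearPMap.map_smul, Submodule.coe_smul, smul_comm w, ← smul_sub, hζ]
  have h' : (η w : H) - η z = (w - z) • (ζ w : H) := by
    rw [← Submodule.coe_sub, h, Submodule.coe_smul]
  rw [slope_def_module, h', smul_smul, inv_mul_cancel₀ (sub_ne_zero.2 hw), one_smul]

/-! ### Norm identities for symmetric operators. -/

theorem IsSymmetricOp.inner_eq (hsym : IsSymmetricOp A) (x y : A.domain) :
    inner ℂ (A x) (y : H) = inner ℂ (x : H) (A y) :=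
  sub_eq_zero.1 ((Submodule.mem_adjoint_iff _ _).1 (hsym (A.mem_graph y)) _ _ (A.mem_graph x))

theorem IsSymmetricOp.norm_sub_smul_sq (hsym : IsSymmetricOp A) (z : ℂ) (x : A.domain) :
    ‖A x - z • (x : H)‖ ^ 2 = ‖A x - (z.re : ℂ) • (x : H)‖ ^ 2 + (z.im * ‖(x : H)‖) ^ 2 := by
  have hreal : (inner ℂ (A x) (x : H)).im = 0 := by
    rw [← Complex.conj_eq_iff_im, inner_conj_symm, hsym.inner_eq]
  rw [@norm_sub_sq ℂ, @norm_sub_sq ℂ _ _ _ _ _ ((z.re : ℂ) • (x : H)), norm_smul, norm_smul,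
    inner_smul_right, inner_smul_right, mul_pow, mul_pow, Complex.sq_norm, Complex.sq_norm]
  simp only [RCLike.re_to_complex, Complex.mul_re, hreal, Complex.normSq_apply, Complex.ofReal_re,
    Complex.ofReal_im]
  ring

theorem IsSymmetricOp.norm_sub_conj_smul (hsym : IsSymmetricOp A) (z : ℂ) (x : A.domain) :
    ‖A x - conj z • (x : H)‖ = ‖A x - z • (x : H)‖ := by
  rw [← sq_eq_sq₀ (norm_nonneg _) (norm_nonneg _), hsym.norm_sub_smul_sq, hsym.norm_sub_smul_sq z]
  simp

theorem IsSymmetricOp.abs_im_mul_norm_le (hsym : IsSymmetricOp A) (z : ℂ) (x : A.domain) :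
    |z.im| * ‖(x : H)‖ ≤ ‖A x - z • (x : H)‖ := by
  refine abs_le_of_sq_le_sq' ?_ (norm_nonneg _) |>.2
  rw [hsym.norm_sub_smul_sq, mul_pow, mul_pow, sq_abs]
  exact le_add_of_nonneg_left (sq_nonneg _)

/-- A vector in the ranges of `A - z I` for all nonreal `z` is also in the ranges at real points. -/
theorem IsRegularOp.mem_ranSub_of_forall_nonreal [CompleteSpace H] (hcl : A.IsClosed)
    (hreg : IsRegularOp A) {φ : H} (h : ∀ z : ℂ, z.im ≠ 0 → φ ∈ ranSub A z) (z : ℂ) :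
    φ ∈ ranSub A z := by
  by_cases hz : z.im ≠ 0
  · exact h z hz
  push Not at hz
  obtain ⟨c, hc, hbound⟩ := hreg.eventually_bound z
  have hmem : ∀ᶠ t : ℝ in 𝓝[≠] 0, φ ∈ ranSub A (z + t * Complex.I) := by
    filter_upwards [self_mem_nhdsWithin] with t ht
    exact h _ (by simpa [hz] using ht)
  have htend : Tendsto (fun t : ℝ => z + t * Complex.I) (𝓝[≠] 0) (𝓝 z) := by
    have : Continuous fun t : ℝ => z + t * Complex.I := by fun_prop
    simpa using (this.tendsto 0).mono_left nhdsWithin_le_nhds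
  refine (ranSub_isClosed hcl hreg z).closure_subset ?_
  refine Metric.mem_closure_iff.2 fun ε hε => ?_
  have hsmall : ∀ᶠ t : ℝ in 𝓝[≠] 0, c⁻¹ * ‖φ‖ * |t| < ε := by
    have : Continuous fun t : ℝ => c⁻¹ * ‖φ‖ * |t| := by fun_prop
    have h0 := (this.tendsto 0).mono_left (nhdsWithin_le_nhds (s := {0}ᶜ))
    exact h0.eventually_lt_const (by simpa using hε)
  obtain ⟨t, ht, htb, hts⟩ := (hmem.and ((htend.eventually hbound).and hsmall)).exists
  obtain ⟨x, hx⟩ := mem_ranSub.1 ht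
  -- For `(A - z - i t) x = φ`, the vector `(A - z) x` misses `φ` by `|t| ‖x‖ ≤ c⁻¹ ‖φ‖ |t|`.
  refine ⟨A x - z • (x : H), mem_ranSub.2 ⟨x, rfl⟩, lt_of_le_of_lt ?_ hts⟩
  have h₁ : φ - (A x - z • (x : H)) = -((t * Complex.I : ℂ) • (x : H)) := by
    rw [← hx]
    module
  have h₂ := htb x
  rw [hx] at h₂
  rw [dist_eq_norm, h₁, norm_neg, norm_smul]
  have h₃ : ‖(x : H)‖ ≤ c⁻¹ * ‖φ‖ := by rwa [inv_mul_eq_div, le_div_iff₀ hc, mul_comm]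
  simpa [mul_comm] using mul_le_mul_of_nonneg_left h₃ (abs_nonneg t)

end Operators

/-- An entire function that is bounded by `C / |Im z|` vanishes. -/
theorem eq_zero_of_abs_im_mul_norm_le {E : Type*} [NormedAddCommGroup E] [NormedSpace ℂ E]
    {f : ℂ → E} (hf : Differentiable ℂ f) {C : ℝ} (hC : ∀ z, |z.im| * ‖f z‖ ≤ C) (z : ℂ) :
    f z = 0 := by
  have hbound : ∀ R : ℝ, ‖z‖ + 1 ≤ R → (R - ‖z‖) * ‖f z‖ ≤ 2 * C := by
    intro R hR
    have hz0 := norm_nonneg z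
    have hR0 : 0 < R := by linarith
    -- On the circle `|w| = R` the factor `w² - R²` has modulus `2 R |Im w|`, which absorbs the
    -- singularity of the bound at the real axis.
    have hmax : ‖(z ^ 2 - (R : ℂ) ^ 2) • f z‖ ≤ 2 * R * C := by
      refine Complex.norm_le_of_forall_mem_frontier_norm_le (U := Metric.ball 0 R)
        (f := fun w => (w ^ 2 - (R : ℂ) ^ 2) • f w) Metric.isBounded_ball
        (Differentiable.diffContOnCl (by fun_prop)) (fun w hw => ?_)
        (subset_closure (by rw [mem_ball_zero_iff]; linarith))
      rw [frontier_ball _ hR0.ne', mem_sphere_zero_iff_norm] at hw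
      have hsq : w.re ^ 2 + w.im ^ 2 = R ^ 2 := by
        rw [← hw, Complex.sq_norm, Complex.normSq_apply]; ring
      have hnorm : ‖w ^ 2 - (R : ℂ) ^ 2‖ = 2 * R * |w.im| := by
        rw [← sq_eq_sq₀ (norm_nonneg _) (by positivity), Complex.sq_norm, Complex.normSq_apply,
          mul_pow, sq_abs]
        simp [pow_two]
        simp only [pow_two] at hsq
        rw [mul_mul_mul_comm 2 R, ← hsq]
        ring
      rw [norm_smul, hnorm, mul_assoc]
      exact mul_le_mul_of_nonneg_left (hC w) (by positivity)
    have hlow : (R - ‖z‖) * R ≤ ‖z ^ 2 - (R : ℂ) ^ 2‖ := by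
      have h := norm_sub_norm_le ((R : ℂ) ^ 2) (z ^ 2)
      rw [norm_sub_rev, norm_pow, norm_pow, Complex.norm_real, Real.norm_of_nonneg hR0.le] at h
      nlinarith
    rw [norm_smul] at hmax
    have h := (mul_le_mul_of_nonneg_right hlow (norm_nonneg (f z))).trans hmax
    refine le_of_mul_le_mul_left ?_ hR0
    linarith
  by_contra h
  have hpos : 0 < ‖f z‖ := norm_pos_iff.2 h
  have hC0 : 0 ≤ C := by simpa using hC 0
  have h₁ := hbound (‖z‖ + 1 + 2 * C / ‖f z‖) (by have : 0 ≤ 2 * C / ‖f z‖ := by positivity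
                                                  linarith)
  have h₂ : (‖z‖ + 1 + 2 * C / ‖f z‖ - ‖z‖) * ‖f z‖ = ‖f z‖ + 2 * C := by
    field_simp
    ring
  linarith

section Operators

variable {H : Type*} [NormedAddCommGroup H] [InnerProductSpace ℂ H] {A : H →ₗ.[ℂ] H}

/-- A closed regular symmetric operator is completely nonselfadjoint. -/
theorem eq_zero_of_forall_mem_ranSub [CompleteSpace H] (hcl : A.IsClosed) (hsym : IsSymmetricOp A)
    (hreg : IsRegularOp A) {φ : H} (h : ∀ z : ℂ, z.im ≠ 0 → φ ∈ ranSub A z) : φ = 0 := by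
  choose η hη using fun z => mem_ranSub.1 (hreg.mem_ranSub_of_forall_nonreal hcl h z)
  have h0 := eq_zero_of_abs_im_mul_norm_le (hreg.differentiable_resolvent hcl hη) (C := ‖φ‖)
    (fun z => by rw [← hη z]; exact hsym.abs_im_mul_norm_le z (η z)) 0
  have h1 : η 0 = 0 := Subtype.ext h0
  rw [← hη 0, h1]
  simp

/-! ### Unitary transport of operators and relations. -/

variable {K : Type*} [NormedAddCommGroup K] [InnerProductSpace ℂ K]

theorem mem_transportRel {U : H ≃ₗᵢ[ℂ] K} {T : Submodule ℂ (H × H)} {φ ψ : H} :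
    (U φ, U ψ) ∈ transportRel U T ↔ (φ, ψ) ∈ T := by
  constructor
  · rintro ⟨⟨a, b⟩, hab, h⟩
    obtain ⟨h₁, h₂⟩ := Prod.mk.inj h
    rwa [← U.injective h₁, ← U.injective h₂]
  · exact fun h => ⟨(φ, ψ), h, rfl⟩

theorem transportRel_adjoint (U : H ≃ₗᵢ[ℂ] K) (T : Submodule ℂ (H × H)) :
    (transportRel U T).adjoint = transportRel U T.adjoint := by
  ext ⟨η, ω⟩
  obtain ⟨η, rfl⟩ := U.surjective η
  obtain ⟨ω, rfl⟩ := U.surjective ω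
  rw [mem_transportRel, Submodule.mem_adjoint_iff, Submodule.mem_adjoint_iff]
  simp only [U.surjective.forall, mem_transportRel, LinearIsometryEquiv.inner_map_map]

theorem graph_transportOp (U : H ≃ₗᵢ[ℂ] K) (A : H →ₗ.[ℂ] H) :
    (transportOp U A).graph = transportRel U A.graph := by
  have key : ∀ x : A.domain, ∀ h : U (x : H) ∈ (transportOp U A).domain,
      transportOp U A ⟨U x, h⟩ = U (A x) := fun x h => by
    change U (A ((U.toLinearEquiv.submoduleMap A.domain).symm _)) = U (A x)
    exact congrArg (fun y => U (A y))
      ((U.toLinearEquiv.submoduleMap A.domain).symm_apply_apply x)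
  ext ⟨φ, ψ⟩
  obtain ⟨φ, rfl⟩ := U.surjective φ
  obtain ⟨ψ, rfl⟩ := U.surjective ψ
  rw [mem_transportRel, LinearPMap.mem_graph_iff', LinearPMap.mem_graph_iff']
  constructor
  · rintro ⟨⟨_, x, hx, rfl⟩, h⟩
    obtain ⟨h₁, h₂⟩ := Prod.mk.inj h
    have h₁' : x = φ := U.injective h₁
    have h₂' : A ⟨x, hx⟩ = ψ := U.injective ((key ⟨x, hx⟩ _).symm.trans h₂)
    exact ⟨⟨x, hx⟩, Prod.ext h₁' h₂'⟩
  · rintro ⟨x, h⟩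
    obtain ⟨rfl, rfl⟩ := Prod.mk.inj h
    exact ⟨⟨U x, x, x.2, rfl⟩, Prod.ext rfl (key x _)⟩

theorem IsCanonicalSelfAdjointExtension.transport {T : Submodule ℂ (H × H)}
    (h : IsCanonicalSelfAdjointExtension A T) (U : H ≃ₗᵢ[ℂ] K) :
    IsCanonicalSelfAdjointExtension (transportOp U A) (transportRel U T) where
  extends_graph := by
    rw [graph_transportOp]
    exact Submodule.map_mono h.extends_graph
  selfAdjoint := by rw [transportRel_adjoint, h.selfAdjoint]

theorem IsInvolution.norm_map {J : H → H} (hJ : IsInvolution J) (φ : H) : ‖J φ‖ = ‖φ‖ := by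
  rw [@norm_eq_sqrt_re_inner ℂ, hJ.inner_map_map, ← @norm_eq_sqrt_re_inner ℂ]

/-! ### The model function and the map `Φ`. -/

variable {J : H → H} {ξ : ℂ → H}

theorem IsModelFunction.inner_apply (hξ : IsModelFunction A J ξ) (z : ℂ) (x : A.domain) :
    inner ℂ (ξ (conj z)) (A x) = z * inner ℂ (ξ (conj z)) (x : H) := by
  have h := sub_eq_zero.1
    ((Submodule.mem_adjoint_iff _ _).1 (hξ.mem_ker (conj z)) _ _ (A.mem_graph x))
  rw [← inner_conj_symm, h, inner_smul_right, map_mul, Complex.conj_conj, inner_conj_symm]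

theorem IsModelFunction.inner_sub_smul (hξ : IsModelFunction A J ξ) (z w : ℂ) (x : A.domain) :
    inner ℂ (ξ (conj z)) (A x - w • (x : H)) = (z - w) * inner ℂ (ξ (conj z)) (x : H) := by
  rw [inner_sub_right, inner_smul_right, hξ.inner_apply, sub_mul]

theorem IsModelFunction.mem_ranSub_of_inner_eq_zero [CompleteSpace H]
    (hξ : IsModelFunction A J ξ) (hA : MemS A) {w : ℂ} (hw : w.im ≠ 0) {φ : H}
    (h : inner ℂ (ξ (conj w)) φ = 0) : φ ∈ ranSub A w := by
  have hfin : Module.finrank ℂ (ranSub A w)ᗮ = 1 := by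
    rcases hw.lt_or_gt with hw | hw
    exacts [hA.deficiency_lower w hw, hA.deficiency_upper w hw]
  have hmem : ξ (conj w) ∈ (ranSub A w)ᗮ := by
    rw [Submodule.mem_orthogonal']
    rintro _ ⟨x, rfl⟩
    exact (hξ.inner_sub_smul w w x).trans (by simp)
  -- The nonzero vector `ξ (conj w)` spans the one-dimensional complement.
  have hspan := (finrank_eq_one_iff_of_nonzero' (⟨_, hmem⟩ : (ranSub A w)ᗮ)
    fun h => hξ.zero_free _ (congrArg Subtype.val h)).1 hfin
  have hφ : φ ∈ (ranSub A w)ᗮᗮ := by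
    rw [Submodule.mem_orthogonal]
    intro u hu
    obtain ⟨c, hc⟩ := hspan ⟨u, hu⟩
    have hc' : c • ξ (conj w) = u := congrArg Subtype.val hc
    rw [← hc', inner_smul_left, h, mul_zero]
  rwa [Submodule.orthogonal_orthogonal_eq_closure,
    (ranSub_isClosed hA.isClosed hA.regular w).submodule_topologicalClosure_eq] at hφ

theorem IsModelFunction.phiMap_injective [CompleteSpace H] (hξ : IsModelFunction A J ξ)
    (hA : MemS A) : Function.Injective (phiMap ξ) := by
  refine (injective_iff_map_eq_zero _).2 fun φ hφ => ?_
  exact eq_zero_of_forall_mem_ranSub hA.isClosed hA.symmetric hA.regular fun z hz =>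
    hξ.mem_ranSub_of_inner_eq_zero hA hz (congrFun hφ z)

theorem IsModelFunction.inner_map (hξ : IsModelFunction A J ξ) (hJ : IsInvolution J) (φ : H)
    (z : ℂ) : inner ℂ (ξ (conj z)) (J φ) = conj (inner ℂ (ξ z) φ) := by
  rw [← hξ.map_conj, hJ.inner_map_map, inner_conj_symm]

/-- `J` moves `ξ` to the linear slot: the function equals `⟪J φ, ξ z⟫`. -/
theorem IsModelFunction.differentiable_inner (hξ : IsModelFunction A J ξ) (hJ : IsInvolution J)
    (φ : H) : Differentiable ℂ fun z => inner ℂ (ξ (conj z)) φ := by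
  have h : (fun z => inner ℂ (ξ (conj z)) φ) = fun z => innerSL ℂ (J φ) (ξ z) := by
    ext z
    rw [innerSL_apply_apply, ← hJ.inner_map_map, hξ.map_conj, Complex.conj_conj]
  rw [h]
  exact (innerSL ℂ (J φ)).differentiable.comp hξ.entire

/-! ### The de Branges axioms and the multiplication operator. -/

variable {hΦ : Function.Injective (phiMap ξ)}

theorem IsModelFunction.isDeBrangesSpace [CompleteSpace H] (hξ : IsModelFunction A J ξ)
    (hA : MemS A) (hJ : IsInvolution J) : IsDeBrangesSpace (ModelSpace ξ hΦ) where
  complete := (phi ξ hΦ).toIsometryEquiv.completeSpace_iff.1 inferInstance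
  entire f := by
    obtain ⟨φ, rfl⟩ := (phi ξ hΦ).surjective f
    exact hξ.differentiable_inner hJ φ
  divide_zero f w hw hfw := by
    obtain ⟨φ, rfl⟩ := (phi ξ hΦ).surjective f
    obtain ⟨x, rfl⟩ := mem_ranSub.1 (hξ.mem_ranSub_of_inner_eq_zero hA hw hfw)
    refine ⟨phi ξ hΦ (A x - conj w • (x : H)), fun z hz => ?_, ?_⟩
    · rw [phi_apply, phi_apply, hξ.inner_sub_smul, hξ.inner_sub_smul]
      have := sub_ne_zero.2 hz
      field_simp
    · rw [LinearIsometryEquiv.norm_map, LinearIsometryEquiv.norm_map,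
        hA.symmetric.norm_sub_conj_smul]
  sharp f := by
    obtain ⟨φ, rfl⟩ := (phi ξ hΦ).surjective f
    refine ⟨phi ξ hΦ (J φ), fun z => ?_, ?_⟩
    · rw [phi_apply, phi_apply, hξ.inner_map hJ, Complex.conj_conj]
    · rw [LinearIsometryEquiv.norm_map, LinearIsometryEquiv.norm_map, hJ.norm_map]

theorem mem_graph_mulOp {B : Type*} [NormedAddCommGroup B] [InnerProductSpace ℂ B]
    [RKHS ℂ B ℂ ℂ] {f g : B} : (f, g) ∈ (mulOp B).graph ↔ ∀ z : ℂ, g z = z * f z := by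
  rw [LinearPMap.mem_graph_iff']
  constructor
  · rintro ⟨x, h⟩ z
    obtain ⟨rfl, rfl⟩ := Prod.mk.inj h
    exact mulOp_apply x z
  · intro h
    refine ⟨⟨f, g, h⟩, Prod.ext rfl (RKHS.ext fun z => ?_)⟩
    exact (mulOp_apply _ z).trans (h z).symm

theorem IsModelFunction.mulOp_eq [CompleteSpace H] (hξ : IsModelFunction A J ξ) (hA : MemS A)
    (hJ : IsInvolution J) : mulOp (ModelSpace ξ hΦ) = transportOp (phi ξ hΦ) A := by
  apply LinearPMap.eq_of_eq_graph
  rw [graph_transportOp]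
  ext ⟨f, g⟩
  obtain ⟨φ, rfl⟩ := (phi ξ hΦ).surjective f
  obtain ⟨ψ, rfl⟩ := (phi ξ hΦ).surjective g
  rw [mem_transportRel, mem_graph_mulOp]
  simp only [phi_apply]
  constructor
  · intro h
    have hI : Complex.I.im ≠ 0 := by simp
    -- `Φ (ψ - i φ) = (z - i) Φ φ` vanishes at `i`; any nonreal point would do.
    have h0 : inner ℂ (ξ (conj Complex.I)) (ψ - Complex.I • φ) = 0 := by
      rw [inner_sub_right, inner_smul_right, h, sub_self]
    obtain ⟨x, hx⟩ := mem_ranSub.1 (hξ.mem_ranSub_of_inner_eq_zero hA hI h0)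
    have hne : Set.EqOn (fun z => inner ℂ (ξ (conj z)) φ) (fun z => inner ℂ (ξ (conj z)) (x : H))
        {Complex.I}ᶜ := by
      intro z hz
      have h1 := hξ.inner_sub_smul z Complex.I x
      rw [hx, inner_sub_right, inner_smul_right, h, ← sub_mul] at h1
      exact mul_left_cancel₀ (sub_ne_zero.2 hz) h1
    -- Cancelling `z - i` loses only the point `i`, recovered by continuity.
    have heq := Continuous.ext_on (dense_compl_singleton Complex.I)
      (hξ.differentiable_inner hJ φ).continuous (hξ.differentiable_inner hJ x).continuous hne
    have hφ : φ = x := hΦ heq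
    rw [hφ] at hx ⊢
    rw [← sub_left_injective hx]
    exact A.mem_graph x
  · intro h z
    obtain ⟨x, hx⟩ := (LinearPMap.mem_graph_iff' A).1 h
    obtain ⟨rfl, rfl⟩ := Prod.mk.inj hx
    exact hξ.inner_apply z x

end Operators

end FunctionalModel

open FunctionalModel in
theorem mainTheorem2 {H : Type*} [NormedAddCommGroup H] [InnerProductSpace ℂ H] [CompleteSpace H]
    (A : H →ₗ.[ℂ] H) (hA : MemS A)
    (J : H → H) (hJ : IsInvolution J)
    (hJcomm : ∀ T : Submodule ℂ (H × H), IsCanonicalSelfAdjointExtension A T → CommutesWith J T)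
    (ξ : ℂ → H) (hξ : IsModelFunction A J ξ) :
    ∃ hΦ : Function.Injective (phiMap ξ),
      (∀ η φ : H, inner ℂ (phi ξ hΦ η) (phi ξ hΦ φ) = inner ℂ η φ) ∧
      IsDeBrangesSpace (ModelSpace ξ hΦ) ∧
      (mulOp (ModelSpace ξ hΦ) = transportOp (phi ξ hΦ) A ∧
        ((mulOp (ModelSpace ξ hΦ)).domain : Set (ModelSpace ξ hΦ)) = phi ξ hΦ '' A.domain) ∧
      (∀ (f : ModelSpace ξ hΦ) (z : ℂ),
        phi ξ hΦ (J ((phi ξ hΦ).symm f)) z = conj (f (conj z))) ∧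
      (∀ T : Submodule ℂ (H × H), IsCanonicalSelfAdjointExtension A T →
        IsCanonicalSelfAdjointExtension (mulOp (ModelSpace ξ hΦ))
          (transportRel (phi ξ hΦ) T)) := by
  have hΦ := hξ.phiMap_injective hA
  have hS : mulOp (ModelSpace ξ hΦ) = transportOp (phi ξ hΦ) A := hξ.mulOp_eq hA hJ
  refine ⟨hΦ, (phi ξ hΦ).inner_map_map, hξ.isDeBrangesSpace hA hJ, ⟨hS, ?_⟩, ?_, ?_⟩
  · rw [hS]
    rfl
  · intro f z
    obtain ⟨φ, rfl⟩ := (phi ξ hΦ).surjective f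
    rw [LinearIsometryEquiv.symm_apply_apply, phi_apply, phi_apply, hξ.inner_map hJ,
      Complex.conj_conj]
  · intro T hT
    rw [hS]
    exact hT.transport _
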